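/- Let $p\ge 1$ and, for $h>0$, let $k_h(x,x')=\exp(-|x-x'|^p/h)$ for $x,x'\in\mathbb R$. There is a constant $D>0$ depending only on $p$ such that the following holds for all $\Delta>0$ and all bandwidths $h>0$ that are small enough that $D\,h^{1/p}\le\Delta$. Let $\mathcal L=\{(x_0,y_0),\dots,(x_n,y_n)\}$ with $x_0<\dots<x_n$ real, $y_i\in\{-1,+1\}$ and $|x_i-x_k|\ge\Delta$ for $i\ne k$. Let $x_j<x_{j+1}$ be neighbours with opposite labels, $y_j\neq y_{j+1}$, and let $I=[x_j+\Delta,\,x_{j+1}-\Delta]$ be the set of points between them at distance at least $\Delta$ from all labelled points. (a) For every $u\in I$ the matrix of $k_h$ on the points $x_0,\dots,x_n,u$ is positive definite. For $u\in I$ let $\mathcal H$ be a reproducing kernel Hilbert space with kernel $k_h$ of functions on a set of reals that contains $x_0,\dots,x_n,u$. (If $p\le 2$ one may take all of $\mathbb R$ and the same $\mathcal H$ for all $u$; if $p>2$, the kernel is not positive semidefinite on $\mathbb R$, and the domain and $\mathcal H$ are allowed to depend on $u$.) Let $f\in\mathcal H$ be the minimum norm interpolant of $\mathcal L$ (the current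 interpolant), let $f^u_{t}\in\mathcal H$, $t\in\{-1,+1\}$ (written $f^u_\pm$), be the minimum norm interpolant of $\mathcal L\cup\{(u,t)\}$, and let $\mathsf{score}(u)=\min\{\|f^u_+\|_{\mathcal H},\|f^u_-\|_{\mathcal H}\}$. Then: (b) these minimum norm interpolants exist and are unique; (c) on $I$, $u\mapsto\|f^u_{y_j}\|_{\mathcal H}$ is strictly increasing and $u\mapsto\|f^u_{y_{j+1}}\|_{\mathcal H}$ is strictly decreasing (so if $y_j=+1$ and $y_{j+1}=-1$, then $\|f^u_+\|$ is increasing and $\|f^u_-\|$ is decreasing in $u$); also $u\mapsto y_jf(u)$ is strictly decreasing on $I$; (d) if $x_{j+1}-x_j\ge3\Delta$, then $f$ has a zero in $I$; (e) if $u^*\in I$ and $f(u^*)=0$, then $\|f^{u^*}_+\|_{\mathcal H}=\|f^{u^*}_-\|_{\mathcal H}$ and $\mathsf{score}(u)<\mathsf{score}(u^*)$ for all $u\in I$ with $u\ne u^*$: on $I$ the score is maximised exactly at the zero crossing of the current interpolant. -/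

import Mathlib

/-- The one-dimensional radial basis kernel `exp (-|x - x'| ^ p / h)`. -/
noncomputable def radialKernel (p h : ℝ) (x x' : ℝ) : ℝ :=
  Real.exp (-(|x - x'| ^ p) / h)

section Interpolation

variable {X : Set ℝ} {H : Type*} [NormedAddCommGroup H] [InnerProductSpace ℝ H] [RKHS ℝ H X ℝ]

/-- The reproducing kernel of the Hilbert space `H` of real functions on the set `X ⊆ ℝ` is the
restriction of `k` to `X`. -/
def HasKernel (H : Type*) [NormedAddCommGroup H] [InnerProductSpace ℝ H] [RKHS ℝ H X ℝ]
    [CompleteSpace H] (k : ℝ → ℝ → ℝ) : Prop :=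
  ∀ s t : X, RKHS.kernel H s t 1 = k s t

open Classical in
/-- The value `g u` of the function `g ∈ H` at a point `u` of its domain `X`
(the convention `0` is used for real numbers `u` outside the domain). -/
noncomputable def valueAt (g : H) (u : ℝ) : ℝ :=
  if hu : u ∈ X then g ⟨u, hu⟩ else 0

/-- `g` interpolates the labelled examples `L`, a set of pairs (point, label). -/
def Interpolates (L : Set (ℝ × ℝ)) (g : H) : Prop :=
  ∀ z ∈ L, valueAt g z.1 = z.2

/-- `g` is a minimum norm interpolant in `H` of the labelled examples `L`. -/
def IsMinNormInterpolant (L : Set (ℝ × ℝ)) (g : H) : Prop :=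
  Interpolates L g ∧ ∀ g' : H, Interpolates L g' → ‖g‖ ≤ ‖g'‖

/-- The function norm score: the norm of the smaller one of the two interpolants obtained by
labelling the new point `+1`, respectively `-1`. -/
noncomputable def normScore (fpos fneg : H) : ℝ :=
  min ‖fpos‖ ‖fneg‖

end Interpolation

/-- The set of labelled examples `(x i, y i)`. -/
def labelledSet {ι : Type*} (x y : ι → ℝ) : Set (ℝ × ℝ) :=
  Set.range fun i => (x i, y i)

open scoped Matrix

/-! With `D = 20` one gets `Δ ^ p / h ≥ 20`, so kernel values at distance `≥ Δ` are tiny and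
summable like a geometric series. Gram matrices are then nearly the identity (off-diagonal row sums
at most 1/450), hence positive definite, and the coefficients `a` of the current interpolant `F` are
close to the labels. Labelling `u` with `t` raises the squared norm by `(t - F u)² / (1 - q u)`,
where `q u` is the quadratic form of the inverse Gram matrix at the vector `k u (x i)`. This
involves only kernel values, so the choice of domain and space for each `u` is immaterial. Between
`u < v` in the gap, let `S` be the drop of the kernel centred at the left neighbour plus the rise of
the one centred at the right neighbour. Decrements shrink exponentially under translation
(`exp_rpow_sub_translate_le`), so all other centres contribute at most `S / 450`. Hence, for left
label `+1`, `F` drops by at least `9/10 * S` while `q` moves by at most `S / 100`; the numerator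
wins (`gap_monotonicity`). At a zero of `F` both increments agree, and the opposite monotonicities
make it the unique maximiser of the minimum. -/

/-! ### Geometric series bounds for separated points -/

/-- Exponentials of a `Δ`-separated family of reals to the right of `c + Δ` are dominated by a
geometric series. -/
theorem sum_exp_le_of_separated {ι : Type*} (s : Finset ι) (x : ι → ℝ) {l Δ c : ℝ} (hΔ : 0 < Δ)
    (hl : 10 ≤ l * Δ) (hsep : ∀ i k, i ≠ k → Δ ≤ |x i - x k|) (hc : ∀ i ∈ s, c + Δ ≤ x i) :
    ∑ i ∈ s, Real.exp (-(l * (x i - c))) ≤ 1 / 900 := by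
  classical
  set τ := Real.exp (-(l * Δ)) with hτ
  have hτ0 : 0 < τ := Real.exp_pos _
  have hτ1 : τ ≤ 1 / 1000 := by
    have h1 : τ ≤ Real.exp (-1) ^ 10 := by
      rw [← Real.exp_nat_mul]
      exact Real.exp_le_exp.2 (by push_cast; linarith)
    have h2 : Real.exp (-1) ≤ 1 / 2 := by
      have := Real.exp_neg_one_lt_d9
      linarith
    calc τ ≤ Real.exp (-1) ^ 10 := h1
      _ ≤ (1 / 2) ^ 10 := pow_le_pow_left₀ (Real.exp_pos _).le h2 10
      _ ≤ 1 / 1000 := by norm_num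
  have hl0 : 0 < l := by
    by_contra h
    nlinarith
  -- Counting whole steps of length `Δ` from `c` gives distinct exponents by separation, so the sum
  -- is dominated by part of a geometric series in `τ`.
  let m : ι → ℕ := fun i => ⌊(x i - c) / Δ⌋₊
  have hm1 : ∀ i ∈ s, 1 ≤ m i := fun i hi => by
    apply Nat.le_floor
    rw [Nat.cast_one, le_div_iff₀ hΔ]
    linarith [hc i hi]
  have hinj : Set.InjOn m s := by
    intro i hi k hk hik
    by_contra hne
    have h0 : ∀ i ∈ s, 0 ≤ (x i - c) / Δ := fun i hi =>
      div_nonneg (by linarith [hc i hi]) hΔ.le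
    have h1 := Nat.floor_le (h0 i hi)
    have h2 := Nat.lt_floor_add_one ((x i - c) / Δ)
    have h3 := Nat.floor_le (h0 k hk)
    have h4 := Nat.lt_floor_add_one ((x k - c) / Δ)
    have h5 : (⌊(x i - c) / Δ⌋₊ : ℝ) = ⌊(x k - c) / Δ⌋₊ := by exact_mod_cast hik
    rw [h5] at h1 h2
    have h6 : |(x i - c) / Δ - (x k - c) / Δ| < 1 := by
      rw [abs_lt]; constructor <;> linarith
    rw [← sub_div, abs_div, abs_of_pos hΔ, div_lt_one hΔ] at h6
    have := hsep i k hne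
    rw [show x i - c - (x k - c) = x i - x k by ring] at h6
    linarith
  have hterm : ∀ i ∈ s, Real.exp (-(l * (x i - c))) ≤ τ * τ ^ (m i - 1) := fun i hi => by
    rw [← pow_succ', Nat.sub_add_cancel (hm1 i hi), hτ, ← Real.exp_nat_mul]
    apply Real.exp_le_exp.2
    have h1 := Nat.floor_le (div_nonneg (by linarith [hc i hi]) hΔ.le : 0 ≤ (x i - c) / Δ)
    rw [le_div_iff₀ hΔ] at h1
    have : l * (m i * Δ) ≤ l * (x i - c) := mul_le_mul_of_nonneg_left h1 hl0.le
    linarith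
  have hinj' : Set.InjOn (fun i => m i - 1) s := fun i hi k hk hik => hinj hi hk (by
    have := hm1 i hi
    have := hm1 k hk
    simp only at hik
    omega)
  calc ∑ i ∈ s, Real.exp (-(l * (x i - c))) ≤ ∑ i ∈ s, τ * τ ^ (m i - 1) := Finset.sum_le_sum hterm
    _ = τ * ∑ n ∈ s.image (fun i => m i - 1), τ ^ n := by
        rw [Finset.sum_image hinj', Finset.mul_sum]
    _ ≤ τ * ∑' n, τ ^ n := by
        gcongr
        exact (summable_geometric_of_lt_one hτ0.le (by linarith)).sum_le_tsum _
          (fun i _ => by positivity)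
    _ = τ * (1 - τ)⁻¹ := by rw [tsum_geometric_of_lt_one hτ0.le (by linarith)]
    _ ≤ 1 / 900 := by
        rw [← div_eq_mul_inv, div_le_div_iff₀ (by linarith) (by norm_num)]
        linarith

/-- Each side of `c` contributes 1/900, the left one by reflection; moving the base point by `r`
pulls out the factor `exp (-(l * r))`. -/
theorem sum_exp_abs_le_of_separated {ι : Type*} (s : Finset ι) (x : ι → ℝ) {l Δ c r : ℝ}
    (hΔ : 0 < Δ) (hl : 10 ≤ l * Δ) (hsep : ∀ i k, i ≠ k → Δ ≤ |x i - x k|)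
    (hc : ∀ i ∈ s, Δ + r ≤ |c - x i|) :
    ∑ i ∈ s, Real.exp (-(l * |c - x i|)) ≤ Real.exp (-(l * r)) * (1 / 450) := by
  classical
  rw [← Finset.sum_filter_add_sum_filter_not s (fun i => c ≤ x i)]
  have h1 : ∑ i ∈ s with c ≤ x i, Real.exp (-(l * |c - x i|)) ≤
      Real.exp (-(l * r)) * (1 / 900) := by
    have := sum_exp_le_of_separated (s.filter (fun i => c ≤ x i)) x (c := c + r) hΔ hl hsep
      (fun i hi => by
        rw [Finset.mem_filter] at hi
        have := hc i hi.1
        rw [abs_of_nonpos (by linarith [hi.2])] at this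
        linarith)
    refine le_trans (le_of_eq ?_) (mul_le_mul_of_nonneg_left this (Real.exp_pos _).le)
    rw [Finset.mul_sum]
    refine Finset.sum_congr rfl fun i hi => ?_
    rw [Finset.mem_filter] at hi
    rw [← Real.exp_add, abs_of_nonpos (by linarith [hi.2])]
    ring_nf
  have h2 : ∑ i ∈ s with ¬ c ≤ x i, Real.exp (-(l * |c - x i|)) ≤
      Real.exp (-(l * r)) * (1 / 900) := by
    have := sum_exp_le_of_separated (s.filter (fun i => ¬ c ≤ x i)) (fun i => - x i)
      (c := - c + r) hΔ hl
      (fun i k hik => by rw [show -x i - -x k = -(x i - x k) by ring, abs_neg]; exact hsep i k hik)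
      (fun i hi => by
        rw [Finset.mem_filter] at hi
        have := hc i hi.1
        rw [abs_of_nonneg (by linarith [hi.2])] at this
        linarith)
    refine le_trans (le_of_eq ?_) (mul_le_mul_of_nonneg_left this (Real.exp_pos _).le)
    rw [Finset.mul_sum]
    refine Finset.sum_congr rfl fun i hi => ?_
    rw [Finset.mem_filter] at hi
    rw [← Real.exp_add, abs_of_nonneg (by linarith [hi.2])]
    ring_nf
  linarith

/-! ### Size and decay of the kernel -/

theorem radialKernel_comm (p h s t : ℝ) : radialKernel p h s t = radialKernel p h t s := by
  unfold radialKernel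
  rw [abs_sub_comm]

theorem radialKernel_self {p : ℝ} (hp : 1 ≤ p) (h s : ℝ) : radialKernel p h s s = 1 := by
  unfold radialKernel
  rw [sub_self, abs_zero, Real.zero_rpow (by linarith)]
  simp

theorem radialKernel_pos (p h s t : ℝ) : 0 < radialKernel p h s t := Real.exp_pos _

/-- Since `p ≥ 1`, beyond `Δ` the power lies above its chord from the origin; this reduces every `p`
to an exponential kernel. -/
theorem rpow_div_self_mul_le {p Δ h s : ℝ} (hp : 1 ≤ p) (hΔ : 0 < Δ) (hh : 0 < h) (hs : Δ ≤ s) :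
    Δ ^ p / h / Δ * s ≤ s ^ p / h := by
  have h1 : s / Δ ≤ (s / Δ) ^ p := by
    have := Real.rpow_le_rpow_of_exponent_le (x := s / Δ) ((one_le_div hΔ).2 hs) hp
    rwa [Real.rpow_one] at this
  rw [Real.div_rpow (by linarith) hΔ.le, le_div_iff₀ (Real.rpow_pos_of_pos hΔ p)] at h1
  calc Δ ^ p / h / Δ * s = s / Δ * Δ ^ p / h := by ring
    _ ≤ s ^ p / h := by gcongr

theorem radialKernel_le_exp {p Δ h s t : ℝ} (hp : 1 ≤ p) (hΔ : 0 < Δ) (hh : 0 < h)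
    (hst : Δ ≤ |s - t|) :
    radialKernel p h s t ≤ Real.exp (-(Δ ^ p / h / Δ * |s - t|)) := by
  unfold radialKernel
  apply Real.exp_le_exp.2
  have := rpow_div_self_mul_le hp hΔ hh hst
  rw [neg_div]
  linarith

theorem sum_radialKernel_le {ι : Type*} (s : Finset ι) (x : ι → ℝ) {p Δ h c r : ℝ} (hp : 1 ≤ p)
    (hΔ : 0 < Δ) (hh : 0 < h) (hl : 20 ≤ Δ ^ p / h) (hr : 0 ≤ r)
    (hsep : ∀ i k, i ≠ k → Δ ≤ |x i - x k|) (hc : ∀ i ∈ s, Δ + r ≤ |c - x i|) :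
    ∑ i ∈ s, radialKernel p h c (x i) ≤ Real.exp (-(Δ ^ p / h / Δ * r)) * (1 / 450) := by
  refine le_trans (Finset.sum_le_sum fun i hi => radialKernel_le_exp hp hΔ hh ?_)
    (sum_exp_abs_le_of_separated s x hΔ ?_ hsep hc)
  · linarith [hc i hi]
  · rw [div_mul_cancel₀ _ hΔ.ne']
    linarith

theorem sum_radialKernel_le' {ι : Type*} (s : Finset ι) (x : ι → ℝ) {p Δ h c : ℝ} (hp : 1 ≤ p)
    (hΔ : 0 < Δ) (hh : 0 < h) (hl : 20 ≤ Δ ^ p / h)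
    (hsep : ∀ i k, i ≠ k → Δ ≤ |x i - x k|) (hc : ∀ i ∈ s, Δ ≤ |c - x i|) :
    ∑ i ∈ s, radialKernel p h c (x i) ≤ 1 / 450 := by
  have := sum_radialKernel_le s x (c := c) (r := 0) hp hΔ hh hl le_rfl hsep (by simpa using hc)
  simpa using this

theorem radialKernel_le {p Δ h s t : ℝ} (hp : 1 ≤ p) (hΔ : 0 < Δ) (hh : 0 < h)
    (hl : 20 ≤ Δ ^ p / h) (hst : Δ ≤ |s - t|) : radialKernel p h s t ≤ 1 / 450 := by
  have := sum_radialKernel_le' (c := s) {()} (fun _ => t) hp hΔ hh hl (fun i k hik => (hik rfl).elim)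
    (fun _ _ => hst)
  simpa using this

/-- The decrements of `s ↦ exp (-s ^ p / h)` shrink exponentially under translation. -/
theorem exp_rpow_sub_translate_le {p Δ h s t m : ℝ} (hp : 1 ≤ p) (hΔ : 0 < Δ) (hh : 0 < h)
    (hl : 2 ≤ Δ ^ p / h) (hs : Δ ≤ s) (hst : s ≤ t) (hm : 0 ≤ m) :
    Real.exp (-((s + m) ^ p) / h) - Real.exp (-((t + m) ^ p) / h) ≤
      Real.exp (-(Δ ^ p / h / Δ / 2 * m)) * (Real.exp (-(s ^ p) / h) - Real.exp (-(t ^ p) / h)) := by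
  set C := Real.exp (-(Δ ^ p / h / Δ / 2 * m)) with hC
  -- The claim reads `g t ≤ g s`, so it suffices that `g' ≤ 0` beyond `Δ`.
  let g : ℝ → ℝ := fun w => C * Real.exp (-(w ^ p) / h) - Real.exp (-((w + m) ^ p) / h)
  have hd : ∀ w, Δ ≤ w → HasDerivAt g
      (C * (Real.exp (-(w ^ p) / h) * (-(p * w ^ (p - 1)) / h)) -
        Real.exp (-((w + m) ^ p) / h) * (-(p * (w + m) ^ (p - 1)) / h)) w := by
    intro w hw
    have h1 : HasDerivAt (fun w : ℝ => w ^ p) (p * w ^ (p - 1)) w :=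
      Real.hasDerivAt_rpow_const (Or.inr hp)
    have h2 : HasDerivAt (fun w : ℝ => (w + m) ^ p) (p * (w + m) ^ (p - 1)) w :=
      (Real.hasDerivAt_rpow_const (x := w + m) (Or.inr hp)).comp_add_const w m
    exact ((h1.neg.div_const h).exp.const_mul C).sub (h2.neg.div_const h).exp
  have hanti : AntitoneOn g (Set.Ici Δ) := by
    apply antitoneOn_of_deriv_nonpos (convex_Ici Δ)
    · exact fun w hw => (hd w hw).continuousAt.continuousWithinAt
    · intro w hw
      rw [interior_Ici] at hw
      exact (hd w (le_of_lt hw)).differentiableAt.differentiableWithinAt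
    · intro w hw
      rw [interior_Ici] at hw
      have hw' : Δ ≤ w := le_of_lt hw
      have hw0 : 0 < w := hΔ.trans hw
      rw [(hd w hw').deriv]
      set z := m / w with hz
      have hz0 : 0 ≤ z := div_nonneg hm hw0.le
      have hwm : w + m = w * (1 + z) := by rw [hz]; field_simp
      have hA : 2 ≤ w ^ p / h := hl.trans (by gcongr)
      set A := w ^ p / h with hAdef
      set B := (1 + z) ^ p with hBdef
      have hB1 : 1 + z ≤ B := by
        have h1 := one_add_mul_self_le_rpow_one_add (s := z) (by linarith) hp
        nlinarith
      have hpow : (w + m) ^ p / h = A * B := by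
        rw [hwm, Real.mul_rpow hw0.le (by linarith), hAdef, hBdef]; ring
      have hpow' : (w + m) ^ (p - 1) ≤ w ^ (p - 1) * B := by
        rw [hwm, Real.mul_rpow hw0.le (by linarith)]
        exact mul_le_mul_of_nonneg_left
          (Real.rpow_le_rpow_of_exponent_le (by linarith) (by linarith)) (by positivity)
      -- The factor `B` from the derivative is absorbed by `B ≤ exp (B - 1)`. What remains is `(A -
      -- 1) * (B - 1) ≥ A * z / 2`, from `A ≥ 2` and `B - 1 ≥ z`; this is why the rate is halved.
      have hexp : B * Real.exp (-((w + m) ^ p) / h) ≤ C * Real.exp (-(w ^ p) / h) := by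
        have h1 : B ≤ Real.exp (B - 1) := by
          have := Real.add_one_le_exp (B - 1)
          linarith
        calc B * Real.exp (-((w + m) ^ p) / h)
            ≤ Real.exp (B - 1) * Real.exp (-((w + m) ^ p) / h) := by gcongr
          _ ≤ C * Real.exp (-(w ^ p) / h) := by
            rw [hC, ← Real.exp_add, ← Real.exp_add]
            apply Real.exp_le_exp.2
            rw [neg_div, neg_div, hpow, ← hAdef]
            have h2 : Δ ^ p / h / Δ * m ≤ A * z := by
              have h3 := rpow_div_self_mul_le hp hΔ hh hw'
              have h4 : m = w * z := by rw [hz]; field_simp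
              calc Δ ^ p / h / Δ * m = (Δ ^ p / h / Δ * w) * z := by rw [h4]; ring
                _ ≤ A * z := by gcongr
            nlinarith
      have hp0 : 0 ≤ p / h := by positivity
      have hw1 : 0 ≤ w ^ (p - 1) := by positivity
      have key : Real.exp (-((w + m) ^ p) / h) * (w + m) ^ (p - 1) ≤
          C * Real.exp (-(w ^ p) / h) * w ^ (p - 1) := by
        calc Real.exp (-((w + m) ^ p) / h) * (w + m) ^ (p - 1)
            ≤ Real.exp (-((w + m) ^ p) / h) * (w ^ (p - 1) * B) := by gcongr
          _ = (B * Real.exp (-((w + m) ^ p) / h)) * w ^ (p - 1) := by ring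
          _ ≤ _ := by gcongr
      have := mul_le_mul_of_nonneg_left key hp0
      calc _ = p / h * (Real.exp (-((w + m) ^ p) / h) * (w + m) ^ (p - 1)) -
            p / h * (C * Real.exp (-(w ^ p) / h) * w ^ (p - 1)) := by ring
        _ ≤ 0 := by linarith
  have := hanti (Set.mem_Ici.2 hs) (Set.mem_Ici.2 (hs.trans hst)) hst
  simp only [g] at this
  linarith

/-! ### Diagonally dominant matrices -/

/-- By Gershgorin, each eigenvalue lies in a disc centred at a diagonal entry that excludes the
nonpositive reals. -/
theorem Matrix.posDef_of_sum_row_lt_diag {n : Type*} [Fintype n] [DecidableEq n]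
    {A : Matrix n n ℝ} (hA : A.IsHermitian)
    (h : ∀ k, ∑ j ∈ Finset.univ.erase k, ‖A k j‖ < A k k) : A.PosDef := by
  rw [hA.posDef_iff_eigenvalues_pos]
  intro i
  have hev : Module.End.HasEigenvalue (Matrix.toLin' A) (hA.eigenvalues i) := by
    refine Module.End.hasEigenvalue_of_hasEigenvector (x := ⇑(hA.eigenvectorBasis i)) ?_
    rw [Module.End.hasEigenvector_iff, Module.End.mem_eigenspace_iff, Matrix.toLin'_apply]
    refine ⟨hA.mulVec_eigenvectorBasis i, fun h0 => ?_⟩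
    exact hA.eigenvectorBasis.orthonormal.ne_zero i (by ext k; exact congrFun h0 k)
  obtain ⟨k, hk⟩ := eigenvalue_mem_ball hev
  rw [mem_closedBall_iff_norm, Real.norm_eq_abs, abs_le] at hk
  linarith [h k, hk.1]

section Dominant

variable {ι : Type*} [Fintype ι] [DecidableEq ι] {A : Matrix ι ι ℝ}

theorem Matrix.exists_mulVec_eq_of_sum_row_lt_diag
    (h : ∀ k, ∑ j ∈ Finset.univ.erase k, ‖A k j‖ < ‖A k k‖) (w : ι → ℝ) : ∃ a, A *ᵥ a = w := by
  refine ⟨A⁻¹ *ᵥ w, ?_⟩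
  rw [Matrix.mulVec_mulVec, Matrix.mul_nonsing_inv _
    (isUnit_iff_ne_zero.2 (det_ne_zero_of_sum_row_lt_diag h)), Matrix.one_mulVec]

theorem Matrix.abs_sub_le_of_mulVec_eq (h1 : ∀ k, A k k = 1)
    (h : ∀ k, ∑ j ∈ Finset.univ.erase k, |A k j| ≤ 1 / 450) {a w : ι → ℝ} (ha : A *ᵥ a = w)
    {M : ℝ} (hw : ∀ i, |w i| ≤ M) (i : ι) : |a i - w i| ≤ M / 400 := by
  -- At an index where `|a|` is largest, row `k` bounds `|a k|` by `450/449 * M`; reinserting this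
  -- gives an error of `M / 449`.
  obtain ⟨k, -, hk⟩ := Finset.exists_max_image Finset.univ (fun i => |a i|) ⟨i, Finset.mem_univ i⟩
  have hrow : ∀ i, |a i - w i| ≤ 1 / 450 * |a k| := by
    intro i
    have h2 : w i = a i + ∑ j ∈ Finset.univ.erase i, A i j * a j := by
      rw [← ha, Matrix.mulVec, dotProduct, ← Finset.add_sum_erase _ _ (Finset.mem_univ i), h1,
        one_mul]
    rw [h2, show a i - (a i + ∑ j ∈ Finset.univ.erase i, A i j * a j) =
      -∑ j ∈ Finset.univ.erase i, A i j * a j by ring, abs_neg]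
    calc |∑ j ∈ Finset.univ.erase i, A i j * a j|
        ≤ ∑ j ∈ Finset.univ.erase i, |A i j * a j| := Finset.abs_sum_le_sum_abs _ _
      _ ≤ ∑ j ∈ Finset.univ.erase i, |A i j| * |a k| := Finset.sum_le_sum fun j _ => by
          rw [abs_mul]
          exact mul_le_mul_of_nonneg_left (hk j (Finset.mem_univ j)) (abs_nonneg _)
      _ = (∑ j ∈ Finset.univ.erase i, |A i j|) * |a k| := by rw [Finset.sum_mul]
      _ ≤ _ := mul_le_mul_of_nonneg_right (h i) (abs_nonneg _)
  have h3 := hrow k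
  have h4 : |a k| ≤ |a k - w k| + |w k| := by
    have := abs_add_le (a k - w k) (w k)
    simpa using this
  linarith [hrow i, hw k, abs_nonneg (a k)]

theorem Matrix.abs_le_of_mulVec_eq (h1 : ∀ k, A k k = 1)
    (h : ∀ k, ∑ j ∈ Finset.univ.erase k, |A k j| ≤ 1 / 450) {a w : ι → ℝ} (ha : A *ᵥ a = w)
    {M : ℝ} (hw : ∀ i, |w i| ≤ M) (i : ι) : |a i| ≤ M * (401 / 400) := by
  have h3 := A.abs_sub_le_of_mulVec_eq h1 h ha hw i
  have h4 : |a i| ≤ |a i - w i| + |w i| := by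
    have := abs_add_le (a i - w i) (w i)
    simpa using this
  linarith [hw i]

end Dominant

/-! ### Minimum norm interpolation -/

section Interpolation

variable {X : Set ℝ} {H : Type*} [NormedAddCommGroup H] [InnerProductSpace ℝ H] [RKHS ℝ H X ℝ]
  [CompleteSpace H]

/-- In a reproducing kernel Hilbert space the minimum norm interpolant of finitely many examples
exists, is unique and is the kernel expansion whose coefficients solve the Gram system. -/
theorem HasKernel.existsUnique_isMinNormInterpolant {ι : Type*} [Fintype ι] {k : ℝ → ℝ → ℝ}
    (hk : HasKernel H k) {x y a : ι → ℝ} (hx : ∀ i, x i ∈ X)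
    (ha : ∀ i, ∑ l, a l * k (x i) (x l) = y i) :
    (∃! g : H, IsMinNormInterpolant (labelledSet x y) g) ∧
    ∀ g : H, IsMinNormInterpolant (labelledSet x y) g →
      (∀ u ∈ X, valueAt g u = ∑ l, a l * k u (x l)) ∧ ‖g‖ ^ 2 = ∑ l, a l * y l := by
  let e : ι → H := fun l => RKHS.kerFun H ⟨x l, hx l⟩ (1 : ℝ)
  let g₀ : H := ∑ l, a l • e l
  have hinner : ∀ (g : H) (u : ℝ) (hu : u ∈ X),
      inner ℝ (RKHS.kerFun H ⟨u, hu⟩ (1 : ℝ)) g = valueAt g u := by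
    intro g u hu
    rw [RKHS.kerFun_inner, valueAt, dif_pos hu]
    simp
  have hinner₀ : ∀ g : H, inner ℝ g₀ g = ∑ l, a l * valueAt g (x l) := by
    intro g
    simp only [g₀, sum_inner, real_inner_smul_left, e, hinner]
  have hval : ∀ u ∈ X, valueAt g₀ u = ∑ l, a l * k u (x l) := by
    intro u hu
    rw [← hinner g₀ u hu]
    rw [inner_sum]
    simp only [real_inner_smul_right, e]
    refine Finset.sum_congr rfl fun l _ => ?_
    rw [hinner, valueAt, dif_pos hu, RKHS.kerFun_apply, hk]
  have hint : Interpolates (labelledSet x y) g₀ := by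
    rintro _ ⟨i, rfl⟩
    simp only
    rw [hval _ (hx i), ha]
  -- The inner product with `g₀` sees only values at the nodes, so it is the same for all
  -- interpolants; Pythagoras follows.
  have horth : ∀ g : H, Interpolates (labelledSet x y) g →
      inner ℝ g₀ g = ∑ l, a l * y l := by
    intro g hg
    rw [hinner₀]
    exact Finset.sum_congr rfl fun l _ => by rw [hg (x l, y l) ⟨l, rfl⟩]
  have hnorm₀ : ‖g₀‖ ^ 2 = ∑ l, a l * y l := by
    rw [← real_inner_self_eq_norm_sq, horth g₀ hint]
  have hpyth : ∀ g : H, Interpolates (labelledSet x y) g →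
      ‖g‖ ^ 2 = ‖g₀‖ ^ 2 + ‖g - g₀‖ ^ 2 := by
    intro g hg
    rw [norm_sub_sq_real, real_inner_comm, horth g hg, hnorm₀]
    ring
  have hmin : IsMinNormInterpolant (labelledSet x y) g₀ := by
    refine ⟨hint, fun g hg => ?_⟩
    have := hpyth g hg
    exact le_of_sq_le_sq (by nlinarith [sq_nonneg ‖g - g₀‖]) (norm_nonneg _)
  have huniq : ∀ g : H, IsMinNormInterpolant (labelledSet x y) g → g = g₀ := by
    intro g hg
    have h1 := hpyth g hg.1
    have h2 := hg.2 g₀ hint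
    have h3 : ‖g - g₀‖ ^ 2 ≤ 0 := by nlinarith [norm_nonneg g, norm_nonneg g₀]
    have h4 : ‖g - g₀‖ = 0 := by nlinarith [norm_nonneg (g - g₀)]
    exact sub_eq_zero.1 (norm_eq_zero.1 h4)
  refine ⟨⟨g₀, hmin, huniq⟩, fun g hg => ?_⟩
  rw [huniq g hg]
  exact ⟨hval, hnorm₀⟩

theorem insert_labelledSet {ι : Type*} (x y : ι → ℝ) (u t : ℝ) :
    insert (u, t) (labelledSet x y) =
      labelledSet (fun o : Option ι => o.elim u x) (fun o => o.elim t y) := by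
  ext z
  simp [labelledSet, Option.exists, eq_comm]

/-- Adding one example to the minimum norm interpolant raises the squared norm by the squared
residual divided by the Schur complement of the Gram matrix. -/
theorem HasKernel.existsUnique_isMinNormInterpolant_insert {ι : Type*} [Fintype ι]
    {k : ℝ → ℝ → ℝ} (hk : HasKernel H k) (hsymm : ∀ s t, k s t = k t s) {x y a b : ι → ℝ} {u : ℝ}
    (hx : ∀ i, x i ∈ X) (hu : u ∈ X)
    (ha : ∀ i, ∑ l, a l * k (x i) (x l) = y i) (hb : ∀ i, ∑ l, b l * k (x i) (x l) = k u (x i))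
    (huu : k u u = 1) (hq : 1 - ∑ l, b l * k u (x l) ≠ 0) (t : ℝ) :
    (∃! g : H, IsMinNormInterpolant (insert (u, t) (labelledSet x y)) g) ∧
    ∀ g : H, IsMinNormInterpolant (insert (u, t) (labelledSet x y)) g →
      ‖g‖ ^ 2 = ∑ l, a l * y l +
        (t - ∑ l, a l * k u (x l)) ^ 2 / (1 - ∑ l, b l * k u (x l)) := by
  set F := ∑ l, a l * k u (x l) with hF
  set q := ∑ l, b l * k u (x l) with hqdef
  set s := (t - F) / (1 - q) with hs
  have hsq : s * (1 - q) = t - F := div_mul_cancel₀ _ hq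
  have hby : ∑ l, b l * y l = F := by
    rw [hF]
    simp_rw [← ha, ← hb, Finset.mul_sum]
    rw [Finset.sum_comm]
    refine Finset.sum_congr rfl fun i _ => Finset.sum_congr rfl fun l _ => ?_
    rw [hsymm (x i) (x l)]
    ring
  -- Block elimination: the new node gets residual over Schur complement, `s`, and the old
  -- coefficients are corrected by `-s * b`.
  have hmain := hk.existsUnique_isMinNormInterpolant
    (x := fun o : Option ι => o.elim u x) (y := fun o => o.elim t y)
    (a := fun o => o.elim s (fun i => a i - s * b i))
    (by rintro (_ | i); exacts [hu, hx i])
    (by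
      rintro (_ | i)
      · simp only [Fintype.sum_option, Option.elim, huu, sub_mul, Finset.sum_sub_distrib]
        simp_rw [mul_assoc, ← Finset.mul_sum]
        rw [← hF, ← hqdef]
        linarith
      · simp only [Fintype.sum_option, Option.elim, sub_mul, Finset.sum_sub_distrib]
        simp_rw [mul_assoc, ← Finset.mul_sum]
        rw [ha, hb, hsymm (x i) u]
        ring)
  rw [insert_labelledSet]
  refine ⟨hmain.1, fun g hg => ?_⟩
  rw [(hmain.2 g hg).2]
  simp only [Fintype.sum_option, Option.elim, sub_mul, Finset.sum_sub_distrib]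
  simp_rw [mul_assoc, ← Finset.mul_sum]
  rw [hby, hs]
  ring

end Interpolation

/-! ### Comparison along a gap -/

/-- After cross-multiplying, the change of the numerators contributes at least `0.81 * S` and that
of the denominators at most `0.02 * S`. -/
theorem sq_div_lt_sq_div {S A B P Q : ℝ} (hS : 0 < S) (hAB : 9 / 10 * S ≤ A - B)
    (hPQ : |P - Q| ≤ S / 100) (hA : |A| ≤ 1 / 100) (hB : |B| ≤ 1 / 100) (hP : |P| ≤ 1 / 100) :
    (1 - A) ^ 2 / (1 - P) < (1 - B) ^ 2 / (1 - Q) := by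
  rw [abs_le] at hPQ hA hB hP
  rw [div_lt_div_iff₀ (by linarith) (by linarith)]
  have h1 : 9 / 10 * S * 1 * (9 / 10) ≤ (A - B) * (2 - A - B) * (1 - P) := by
    have h3 : 9 / 10 * S * 1 ≤ (A - B) * (2 - A - B) :=
      mul_le_mul hAB (by linarith) (by norm_num) (by linarith)
    exact mul_le_mul h3 (by linarith) (by norm_num) (by nlinarith)
  have h2 : (1 - A) ^ 2 * (P - Q) ≤ 2 * (S / 100) := by
    have h4 : (1 - A) ^ 2 ≤ 2 := by nlinarith
    have h5 : (1 - A) ^ 2 * (P - Q) ≤ (1 - A) ^ 2 * (S / 100) :=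
      mul_le_mul_of_nonneg_left (by linarith) (sq_nonneg _)
    have h6 : (1 - A) ^ 2 * (S / 100) ≤ 2 * (S / 100) :=
      mul_le_mul_of_nonneg_right h4 (by linarith)
    linarith
  linarith [show (1 - B) ^ 2 * (1 - P) - (1 - A) ^ 2 * (1 - Q) =
    (A - B) * (2 - A - B) * (1 - P) - (1 - A) ^ 2 * (P - Q) by ring]

theorem radialKernel_posDef_of_separated {p Δ h : ℝ} (hp : 1 ≤ p) (hΔ : 0 < Δ) (hh : 0 < h)
    (hl : 20 ≤ Δ ^ p / h) {s : Set ℝ} (hs : s.Finite)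
    (hsep : ∀ a ∈ s, ∀ b ∈ s, a ≠ b → Δ ≤ |a - b|) :
    (Matrix.of fun a b : ↥s => radialKernel p h a b).PosDef := by
  classical
  have := hs.fintype
  apply Matrix.posDef_of_sum_row_lt_diag
  · ext a b
    simp [radialKernel_comm p h b a]
  · intro k
    simp only [Matrix.of_apply, radialKernel_self hp, Real.norm_eq_abs,
      abs_of_pos (radialKernel_pos _ _ _ _)]
    have hsep' : ∀ a b : ↥s, a ≠ b → Δ ≤ |(a : ℝ) - b| := fun a b hab =>
      hsep a a.2 b b.2 (fun h => hab (Subtype.ext h))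
    have := sum_radialKernel_le' (Finset.univ.erase k) (fun a : ↥s => (a : ℝ)) (c := (k : ℝ)) hp hΔ
      hh hl hsep' (fun i hi => hsep' k i (Finset.ne_of_mem_erase hi).symm)
    linarith

section Gap

variable {ι : Type*} {p Δ h : ℝ} {x : ι → ℝ} {j j' : ι}

theorem radialKernel_gram_row_le [Fintype ι] [DecidableEq ι]
    (hp : 1 ≤ p) (hΔ : 0 < Δ) (hh : 0 < h)
    (hl : 20 ≤ Δ ^ p / h) (hsep : ∀ i k, i ≠ k → Δ ≤ |x i - x k|) (i : ι) :
    ∑ k ∈ Finset.univ.erase i, |Matrix.of (fun i k => radialKernel p h (x i) (x k)) i k| ≤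
      1 / 450 := by
  simp only [Matrix.of_apply, abs_of_pos (radialKernel_pos _ _ _ _)]
  exact sum_radialKernel_le' _ x hp hΔ hh hl hsep
    fun k hk => hsep i k (Finset.ne_of_mem_erase hk).symm

theorem exists_radialKernel_coeff [Fintype ι] [DecidableEq ι]
    (hp : 1 ≤ p) (hΔ : 0 < Δ) (hh : 0 < h)
    (hl : 20 ≤ Δ ^ p / h) (hsep : ∀ i k, i ≠ k → Δ ≤ |x i - x k|) {w : ι → ℝ} {M : ℝ}
    (hw : ∀ i, |w i| ≤ M) : ∃ a : ι → ℝ, (∀ i, ∑ l, a l * radialKernel p h (x i) (x l) = w i) ∧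
      (∀ i, |a i| ≤ M * (401 / 400)) ∧ ∀ i, |a i - w i| ≤ M / 400 := by
  have hrow := radialKernel_gram_row_le hp hΔ hh hl hsep
  have hdiag : ∀ k, Matrix.of (fun i k => radialKernel p h (x i) (x k)) k k = 1 := fun k => by
    rw [Matrix.of_apply, radialKernel_self hp]
  obtain ⟨a, ha⟩ := Matrix.exists_mulVec_eq_of_sum_row_lt_diag
    (A := Matrix.of (fun i k => radialKernel p h (x i) (x k)))
    (fun k => by
      rw [hdiag k]
      simp only [Real.norm_eq_abs]
      refine (hrow k).trans_lt ?_
      norm_num) w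
  refine ⟨a, fun i => ?_, Matrix.abs_le_of_mulVec_eq hdiag hrow ha hw,
    Matrix.abs_sub_le_of_mulVec_eq hdiag hrow ha hw⟩
  rw [← ha, Matrix.mulVec, dotProduct]
  exact Finset.sum_congr rfl fun l _ => by rw [Matrix.of_apply, mul_comm]

/-- The decrement of the kernel between two positions right of `x j` is dominated, for the centres
left of `x j`, by the decrement at `x j`. -/
theorem radialKernel_sub_le_of_le (hp : 1 ≤ p) (hΔ : 0 < Δ) (hh : 0 < h) (hl : 20 ≤ Δ ^ p / h)
    {u v a b : ℝ} (hu : a + Δ ≤ u) (huv : u ≤ v) (hb : b ≤ a) :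
    |radialKernel p h u b - radialKernel p h v b| ≤
      Real.exp (-(Δ ^ p / h / Δ / 2 * (a - b))) * (radialKernel p h u a - radialKernel p h v a) := by
  have key := exp_rpow_sub_translate_le (s := u - a) (t := v - a) (m := a - b) hp hΔ hh
    (by linarith) (by linarith) (by linarith) (by linarith)
  have hmono : radialKernel p h v b ≤ radialKernel p h u b := by
    unfold radialKernel
    rw [abs_of_nonneg (by linarith), abs_of_nonneg (by linarith)]
    apply Real.exp_le_exp.2
    have : (u - b) ^ p ≤ (v - b) ^ p :=
      Real.rpow_le_rpow (by linarith) (by linarith) (by linarith)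
    gcongr
  rw [abs_of_nonneg (by linarith)]
  unfold radialKernel
  rw [abs_of_nonneg (by linarith), abs_of_nonneg (by linarith), abs_of_nonneg (by linarith),
    abs_of_nonneg (by linarith)]
  convert key using 6 <;> ring

theorem radialKernel_neg_neg (p h s t : ℝ) :
    radialKernel p h (-s) (-t) = radialKernel p h s t := by
  unfold radialKernel
  rw [show -s - -t = -(s - t) by ring, abs_neg]

theorem radialKernel_sub_pos (hp : 1 ≤ p) (hh : 0 < h) {u v a : ℝ} (hu : a ≤ u) (huv : u < v) :
    0 < radialKernel p h u a - radialKernel p h v a := by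
  unfold radialKernel
  rw [abs_of_nonneg (by linarith), abs_of_nonneg (by linarith), sub_pos]
  apply Real.exp_lt_exp.2
  have : (u - a) ^ p < (v - a) ^ p :=
    Real.rpow_lt_rpow (by linarith) (by linarith) (by linarith)
  gcongr

theorem sum_abs_radialKernel_sub_le_of_le (s : Finset ι) (hp : 1 ≤ p) (hΔ : 0 < Δ) (hh : 0 < h)
    (hl : 20 ≤ Δ ^ p / h) (hsep : ∀ i k, i ≠ k → Δ ≤ |x i - x k|) {u v : ℝ} (hu : x j + Δ ≤ u)
    (huv : u < v) (hs : ∀ i ∈ s, i ≠ j ∧ x i ≤ x j) :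
    ∑ i ∈ s, |radialKernel p h u (x i) - radialKernel p h v (x i)| ≤
      (radialKernel p h u (x j) - radialKernel p h v (x j)) / 450 := by
  have hpos := radialKernel_sub_pos hp hh (by linarith : x j ≤ u) huv
  -- The halved decay rate still meets the threshold 10, which is what the constant 20 is for.
  have hsum := sum_exp_abs_le_of_separated s x (l := Δ ^ p / h / Δ / 2) (c := x j) (r := 0) hΔ
    (by
      rw [show Δ ^ p / h / Δ / 2 * Δ = Δ ^ p / h / Δ * Δ / 2 by ring, div_mul_cancel₀ _ hΔ.ne']
      linarith) hsep
    (fun i hi => by rw [add_zero]; exact hsep j i (hs i hi).1.symm)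
  rw [mul_zero, neg_zero, Real.exp_zero, one_mul] at hsum
  calc _ ≤ ∑ i ∈ s, Real.exp (-(Δ ^ p / h / Δ / 2 * |x j - x i|)) *
        (radialKernel p h u (x j) - radialKernel p h v (x j)) := Finset.sum_le_sum fun i hi => by
          rw [abs_of_nonneg (by linarith [(hs i hi).2] : 0 ≤ x j - x i)]
          exact radialKernel_sub_le_of_le hp hΔ hh hl hu huv.le (hs i hi).2
    _ ≤ 1 / 450 * (radialKernel p h u (x j) - radialKernel p h v (x j)) := by
        rw [← Finset.sum_mul]
        exact mul_le_mul_of_nonneg_right hsum hpos.le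
    _ = _ := by ring

/-- Centres on the left are charged to the drop at `x j`; those on the right, after reflection, to
the rise at `x j'`. -/
theorem sum_abs_radialKernel_sub_le [Fintype ι] [DecidableEq ι]
    (hp : 1 ≤ p) (hΔ : 0 < Δ) (hh : 0 < h)
    (hl : 20 ≤ Δ ^ p / h) (hsep : ∀ i k, i ≠ k → Δ ≤ |x i - x k|)
    (hgap : ∀ i, x i ≤ x j ∨ x j' ≤ x i) {u v : ℝ} (hu : x j + Δ ≤ u)
    (huv : u < v) (hv : v ≤ x j' - Δ) :
    ∑ i ∈ (Finset.univ.erase j).erase j', |radialKernel p h u (x i) - radialKernel p h v (x i)| ≤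
      ((radialKernel p h u (x j) - radialKernel p h v (x j)) +
        (radialKernel p h v (x j') - radialKernel p h u (x j'))) / 450 := by
  rw [← Finset.sum_filter_add_sum_filter_not _ (fun i => x i ≤ x j), add_div]
  apply add_le_add
  · apply sum_abs_radialKernel_sub_le_of_le _ hp hΔ hh hl hsep hu huv
    intro i hi
    simp only [Finset.mem_filter, Finset.mem_erase] at hi
    exact ⟨hi.1.2.1, hi.2⟩
  · have := sum_abs_radialKernel_sub_le_of_le (x := fun i => - x i) (j := j') (u := -v) (v := -u)
      (((Finset.univ.erase j).erase j').filter (fun i => ¬ x i ≤ x j)) hp hΔ hh hl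
      (fun i k hik => by rw [show -x i - -x k = -(x i - x k) by ring, abs_neg]; exact hsep i k hik)
      (by linarith) (by linarith)
      (fun i hi => by
        simp only [Finset.mem_filter, Finset.mem_erase] at hi
        exact ⟨hi.1.1, by linarith [(hgap i).resolve_left hi.2]⟩)
    simp only [radialKernel_neg_neg] at this
    refine le_trans (le_of_eq ?_) this
    exact Finset.sum_congr rfl fun i _ => abs_sub_comm _ _

theorem abs_sum_mul_radialKernel_sub_le [Fintype ι] [DecidableEq ι]
    (hp : 1 ≤ p) (hΔ : 0 < Δ) (hh : 0 < h)
    (hl : 20 ≤ Δ ^ p / h) (hsep : ∀ i k, i ≠ k → Δ ≤ |x i - x k|)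
    (hgap : ∀ i, x i ≤ x j ∨ x j' ≤ x i) {u v : ℝ} (hu : x j + Δ ≤ u)
    (huv : u < v) (hv : v ≤ x j' - Δ) {c : ι → ℝ} {M : ℝ} (hc : ∀ i, |c i| ≤ M) :
    |∑ i, c i * (radialKernel p h u (x i) - radialKernel p h v (x i)) -
      (c j * (radialKernel p h u (x j) - radialKernel p h v (x j)) -
        c j' * (radialKernel p h v (x j') - radialKernel p h u (x j')))| ≤
      M * (((radialKernel p h u (x j) - radialKernel p h v (x j)) +
        (radialKernel p h v (x j') - radialKernel p h u (x j'))) / 450) := by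
  have hjj : j' ≠ j := by rintro rfl; linarith
  have hM : 0 ≤ M := (abs_nonneg _).trans (hc j)
  rw [← Finset.add_sum_erase _ _ (Finset.mem_univ j),
    ← Finset.add_sum_erase _ _ (Finset.mem_erase.2 ⟨hjj, Finset.mem_univ j'⟩)]
  refine le_trans ?_ (mul_le_mul_of_nonneg_left
    (sum_abs_radialKernel_sub_le hp hΔ hh hl hsep hgap hu huv hv) hM)
  rw [Finset.mul_sum]
  refine le_trans (le_of_eq ?_) ((Finset.abs_sum_le_sum_abs _ _).trans
    (Finset.sum_le_sum fun i _ => (abs_mul (c i) _).trans_le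
      (mul_le_mul_of_nonneg_right (hc i) (abs_nonneg _))))
  congr 1
  ring

theorem abs_sub_of_mem_gap (hgap : ∀ i, x i ≤ x j ∨ x j' ≤ x i) {u : ℝ} (hu : x j + Δ ≤ u)
    (hv : u ≤ x j' - Δ) (i : ι) : Δ ≤ |u - x i| := by
  rw [le_abs]
  rcases hgap i with h | h
  · left; linarith
  · right; linarith

theorem abs_sum_mul_radialKernel_le [Fintype ι]
    (hp : 1 ≤ p) (hΔ : 0 < Δ) (hh : 0 < h)
    (hl : 20 ≤ Δ ^ p / h) (hsep : ∀ i k, i ≠ k → Δ ≤ |x i - x k|) {u : ℝ}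
    (hu : ∀ i, Δ ≤ |u - x i|) {c : ι → ℝ} {M : ℝ} (hM : 0 ≤ M) (hc : ∀ i, |c i| ≤ M) :
    |∑ i, c i * radialKernel p h u (x i)| ≤ M / 450 := by
  have h1 := sum_radialKernel_le' Finset.univ x hp hΔ hh hl hsep (fun i _ => hu i)
  calc _ ≤ ∑ i, |c i * radialKernel p h u (x i)| := Finset.abs_sum_le_sum_abs _ _
    _ ≤ ∑ i, M * radialKernel p h u (x i) := Finset.sum_le_sum fun i _ => by
        rw [abs_mul, abs_of_pos (radialKernel_pos _ _ _ _)]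
        exact mul_le_mul_of_nonneg_right (hc i) (radialKernel_pos _ _ _ _).le
    _ = M * ∑ i, radialKernel p h u (x i) := by rw [Finset.mul_sum]
    _ ≤ M * (1 / 450) := mul_le_mul_of_nonneg_left h1 hM
    _ = M / 450 := by ring

/-- At distance `Δ` from `x i` and at distance `2 * Δ` from the other centres, a kernel expansion
has the sign of its coefficient at `x i`. -/
theorem sum_mul_radialKernel_pos [Fintype ι] [DecidableEq ι]
    (hp : 1 ≤ p) (hΔ : 0 < Δ) (hh : 0 < h)
    (hl : 20 ≤ Δ ^ p / h) (hsep : ∀ i k, i ≠ k → Δ ≤ |x i - x k|) {u : ℝ} {i : ι}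
    (hui : |u - x i| = Δ) (hu : ∀ k, k ≠ i → 2 * Δ ≤ |u - x k|) {c : ι → ℝ}
    (hc : ∀ i, |c i| ≤ 2) (hci : 1 / 2 ≤ c i) :
    0 < ∑ i, c i * radialKernel p h u (x i) := by
  rw [← Finset.add_sum_erase _ _ (Finset.mem_univ i)]
  -- With `r = Δ` the extra decay factor is exactly the kernel value at `x i`, so the other centres
  -- total at most 1/450 of it.
  have h1 := sum_radialKernel_le (Finset.univ.erase i) x (c := u) (r := Δ) hp hΔ hh hl hΔ.le hsep
    (fun k hk => by linarith [hu k (Finset.ne_of_mem_erase hk)])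
  have h2 : radialKernel p h u (x i) = Real.exp (-(Δ ^ p / h / Δ * Δ)) := by
    unfold radialKernel
    rw [hui, div_mul_cancel₀ _ hΔ.ne', neg_div]
  rw [← h2] at h1
  have hpos := radialKernel_pos p h u (x i)
  have h3 : -∑ k ∈ Finset.univ.erase i, c k * radialKernel p h u (x k) ≤
      2 * ∑ k ∈ Finset.univ.erase i, radialKernel p h u (x k) := by
    rw [← Finset.sum_neg_distrib, Finset.mul_sum]
    refine Finset.sum_le_sum fun k _ => ?_
    rw [← neg_mul]
    exact mul_le_mul_of_nonneg_right (by linarith [(abs_le.1 (hc k)).1])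
      (radialKernel_pos _ _ _ _).le
  nlinarith

theorem continuous_radialKernel (hp : 1 ≤ p) (a : ℝ) :
    Continuous fun u => radialKernel p h u a := by
  unfold radialKernel
  have : Continuous fun u : ℝ => |u - a| ^ p :=
    (by fun_prop : Continuous fun u : ℝ => |u - a|).rpow_const fun _ => Or.inr (by linarith)
  fun_prop

/-- Monotonicity of the kernel expansion `F = ∑ a l * k (·) (x l)` and of the two squared norm
increments along a gap whose end points carry opposite labels. -/
theorem gap_monotonicity [Fintype ι] [DecidableEq ι]
    (hp : 1 ≤ p) (hΔ : 0 < Δ) (hh : 0 < h)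
    (hl : 20 ≤ Δ ^ p / h) (hsep : ∀ i k, i ≠ k → Δ ≤ |x i - x k|)
    (hgap : ∀ i, x i ≤ x j ∨ x j' ≤ x i) {u v : ℝ} (hu : x j + Δ ≤ u)
    (huv : u < v) (hv : v ≤ x j' - Δ) {a b b' : ι → ℝ} (ha : ∀ i, |a i| ≤ 2)
    (haj : 99 / 100 ≤ a j) (haj' : a j' ≤ -(99 / 100))
    (hb : ∀ i, ∑ l, b l * radialKernel p h (x i) (x l) = radialKernel p h u (x i))
    (hb' : ∀ i, ∑ l, b' l * radialKernel p h (x i) (x l) = radialKernel p h v (x i))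
    (hbM : ∀ i, |b i| ≤ 1 / 400) (hbM' : ∀ i, |b' i| ≤ 1 / 400) :
    ∑ l, a l * radialKernel p h v (x l) < ∑ l, a l * radialKernel p h u (x l) ∧
    (1 - ∑ l, a l * radialKernel p h u (x l)) ^ 2 / (1 - ∑ l, b l * radialKernel p h u (x l)) <
      (1 - ∑ l, a l * radialKernel p h v (x l)) ^ 2 / (1 - ∑ l, b' l * radialKernel p h v (x l)) ∧
    (1 + ∑ l, a l * radialKernel p h v (x l)) ^ 2 / (1 - ∑ l, b' l * radialKernel p h v (x l)) <
      (1 + ∑ l, a l * radialKernel p h u (x l)) ^ 2 / (1 - ∑ l, b l * radialKernel p h u (x l)) := by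
  have hdu := abs_sub_of_mem_gap hgap hu (huv.le.trans hv)
  have hdv := abs_sub_of_mem_gap hgap (hu.trans huv.le) hv
  have hFu := abs_sum_mul_radialKernel_le hp hΔ hh hl hsep hdu (by norm_num) ha
  have hFv := abs_sum_mul_radialKernel_le hp hΔ hh hl hsep hdv (by norm_num) ha
  have hqu := abs_sum_mul_radialKernel_le hp hΔ hh hl hsep hdu (by norm_num) hbM
  have hqv := abs_sum_mul_radialKernel_le hp hΔ hh hl hsep hdv (by norm_num) hbM'
  have hA := radialKernel_sub_pos (a := x j) hp hh (by linarith) huv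
  have hB : 0 < radialKernel p h v (x j') - radialKernel p h u (x j') := by
    have := radialKernel_sub_pos (u := -v) (v := -u) (a := -x j') hp hh (by linarith) (by linarith)
    simpa only [radialKernel_neg_neg] using this
  have hF := abs_sum_mul_radialKernel_sub_le hp hΔ hh hl hsep hgap hu huv hv ha
  have hbb : ∀ i, |b i + b' i| ≤ 1 / 200 := fun i =>
    (abs_add_le _ _).trans (by linarith [hbM i, hbM' i])
  have hq := abs_sum_mul_radialKernel_sub_le hp hΔ hh hl hsep hgap hu huv hv hbb
  have hsum_sub : ∑ i, a i * (radialKernel p h u (x i) - radialKernel p h v (x i)) =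
      ∑ l, a l * radialKernel p h u (x l) - ∑ l, a l * radialKernel p h v (x l) := by
    simp only [mul_sub, Finset.sum_sub_distrib]
  -- Symmetry of the Gram matrix; it turns `qu - qv` into the pairing of `b + b'` with the kernel
  -- differences, and `b + b'` is small.
  have hcross : ∑ l, b l * radialKernel p h v (x l) = ∑ l, b' l * radialKernel p h u (x l) := by
    simp_rw [← hb, ← hb', Finset.mul_sum]
    rw [Finset.sum_comm]
    refine Finset.sum_congr rfl fun i _ => Finset.sum_congr rfl fun l _ => ?_
    rw [radialKernel_comm p h (x i) (x l)]
    ring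
  have hq_sub : ∑ i, (b i + b' i) * (radialKernel p h u (x i) - radialKernel p h v (x i)) =
      ∑ l, b l * radialKernel p h u (x l) - ∑ l, b' l * radialKernel p h v (x l) := by
    simp only [mul_sub, add_mul, Finset.sum_sub_distrib, Finset.sum_add_distrib]
    linarith
  rw [hsum_sub] at hF
  rw [hq_sub] at hq
  have hbj := abs_le.1 (hbb j)
  have hbj' := abs_le.1 (hbb j')
  set A := radialKernel p h u (x j) - radialKernel p h v (x j)
  set B := radialKernel p h v (x j') - radialKernel p h u (x j')
  set Fu := ∑ l, a l * radialKernel p h u (x l)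
  set Fv := ∑ l, a l * radialKernel p h v (x l)
  set qu := ∑ l, b l * radialKernel p h u (x l)
  set qv := ∑ l, b' l * radialKernel p h v (x l)
  have h1 : 9 / 10 * (A + B) ≤ Fu - Fv := by
    have := (abs_le.1 hF).1
    nlinarith
  have h2 : |qu - qv| ≤ (A + B) / 100 := by
    rw [abs_le] at hq ⊢
    constructor <;> nlinarith
  refine ⟨by linarith, ?_, ?_⟩
  · exact sq_div_lt_sq_div (by linarith) h1 h2 (by linarith) (by linarith) (by linarith)
  -- The label `-1` is the same comparison with `F` negated and `u`, `v` exchanged.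
  · have := sq_div_lt_sq_div (S := A + B) (A := -Fv) (B := -Fu) (P := qv) (Q := qu) (by linarith)
      (by linarith) (by rw [abs_sub_comm]; exact h2) (by rw [abs_neg]; linarith)
      (by rw [abs_neg]; linarith) (by linarith)
    simpa only [sub_neg_eq_add] using this

end Gap

/-! ### Assembly -/

theorem twenty_le_rpow_div {p Δ h : ℝ} (hp : 1 ≤ p) (hh : 0 < h) (hD : 20 * h ^ (1 / p) ≤ Δ) :
    20 ≤ Δ ^ p / h := by
  rw [le_div_iff₀ hh]
  have h1 : (20 * h ^ (1 / p)) ^ p ≤ Δ ^ p :=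
    Real.rpow_le_rpow (by positivity) hD (by linarith)
  rw [Real.mul_rpow (by norm_num) (by positivity), ← Real.rpow_mul hh.le,
    one_div_mul_cancel (by linarith), Real.rpow_one] at h1
  have h2 : (20 : ℝ) ≤ 20 ^ p := by
    have := Real.rpow_le_rpow_of_exponent_le (x := 20) (by norm_num) hp
    rwa [Real.rpow_one] at this
  nlinarith

theorem propositionp (p : ℝ) (hp : 1 ≤ p) :
    ∃ D : ℝ, 0 < D ∧
      ∀ (Δ h : ℝ), 0 < Δ → 0 < h → D * h ^ (1 / p) ≤ Δ →
      ∀ (n : ℕ) (x y : Fin (n + 1) → ℝ), StrictMono x →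
        (∀ i k, i ≠ k → Δ ≤ |x i - x k|) →
        (∀ i, y i = 1 ∨ y i = -1) →
      -- two neighbouring labelled points with opposite labels
      ∀ j : Fin n, y j.castSucc ≠ y j.succ →
      -- the positions between them at distance at least `Δ` from both
      ∀ I : Set ℝ, I = Set.Icc (x j.castSucc + Δ) (x j.succ - Δ) →
        -- the kernel is positive definite on the labelled points and any such position
        (∀ u ∈ I, (Matrix.of fun s t : ↥(insert u (Set.range x)) =>
          radialKernel p h s t).PosDef) ∧
        -- any reproducing kernel Hilbert space of this kernel whose domain contains these points;
        -- domain and space may, but need not, be the same for all `u`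
        ∀ (X : ℝ → Set ℝ) (H : ℝ → Type*) [∀ u, NormedAddCommGroup (H u)]
          [∀ u, InnerProductSpace ℝ (H u)] [∀ u, CompleteSpace (H u)]
          [∀ u, RKHS ℝ (H u) (X u) ℝ],
          (∀ u ∈ I, insert u (Set.range x) ⊆ X u) →
          (∀ u ∈ I, HasKernel (H u) (radialKernel p h)) →
          -- the minimum norm interpolants exist and are unique
          (∀ u ∈ I, (∃! g : H u, IsMinNormInterpolant (labelledSet x y) g) ∧
            ∀ t : ℝ, t = 1 ∨ t = -1 →
              ∃! g : H u, IsMinNormInterpolant (insert (u, t) (labelledSet x y)) g) ∧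
          -- `f u` is the current interpolant, `fnew t u` the one after labelling `u` with `t`
          ∀ (f : ∀ u, H u) (fnew : ℝ → ∀ u, H u),
            (∀ u ∈ I, IsMinNormInterpolant (labelledSet x y) (f u)) →
            (∀ u ∈ I, ∀ t : ℝ, t = 1 ∨ t = -1 →
              IsMinNormInterpolant (insert (u, t) (labelledSet x y)) (fnew t u)) →
            StrictMonoOn (fun u => ‖fnew (y j.castSucc) u‖) I ∧
            StrictAntiOn (fun u => ‖fnew (y j.succ) u‖) I ∧
            StrictAntiOn (fun u => y j.castSucc * valueAt (f u) u) I ∧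
            (3 * Δ ≤ x j.succ - x j.castSucc → ∃ u ∈ I, valueAt (f u) u = 0) ∧
            ∀ us ∈ I, valueAt (f us) us = 0 →
              ‖fnew 1 us‖ = ‖fnew (-1) us‖ ∧
              ∀ u ∈ I, u ≠ us →
                normScore (fnew 1 u) (fnew (-1) u) < normScore (fnew 1 us) (fnew (-1) us) := by

  refine ⟨20, by norm_num, ?_⟩
  intro Δ h hΔ hh hD n x y hx hsep hy j hyj I hI
  have hl := twenty_le_rpow_div hp hh hD
  set η := y j.castSucc with hη
  have hη2 : η = 1 ∨ η = -1 := hy _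
  have hηη : η * η = 1 := by rcases hη2 with h | h <;> rw [h] <;> norm_num
  have hy' : y j.succ = -η := by
    rcases hη2 with h1 | h1 <;> rcases hy j.succ with h2 | h2
    · exact absurd (h1.trans h2.symm) hyj
    · rw [h1, h2]
    · rw [h1, h2, neg_neg]
    · exact absurd (h1.trans h2.symm) hyj
  have habs : ∀ i, |y i| ≤ 1 := fun i => by rcases hy i with h | h <;> rw [h] <;> norm_num
  have hgap : ∀ i, x i ≤ x j.castSucc ∨ x j.succ ≤ x i := fun i => by
    rcases le_or_gt i j.castSucc with h | h
    · exact Or.inl (hx.monotone h)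
    · exact Or.inr (hx.monotone (Fin.castSucc_lt_iff_succ_le.1 h))
  have hdist : ∀ u ∈ I, ∀ i, Δ ≤ |u - x i| := fun u hu => by
    rw [hI] at hu
    exact abs_sub_of_mem_gap hgap hu.1 hu.2
  refine ⟨fun u hu => ?_, ?_⟩
  · apply radialKernel_posDef_of_separated hp hΔ hh hl ((Set.finite_range x).insert u)
    rintro _ (rfl | ⟨i, rfl⟩) _ (rfl | ⟨k, rfl⟩) hne
    · exact absurd rfl hne
    · exact hdist _ hu k
    · rw [abs_sub_comm]
      exact hdist _ hu i
    · exact hsep i k (fun h => hne (by rw [h]))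
  intro X H _ _ _ _ hX hk
  obtain ⟨a, ha, haM, hay⟩ := exists_radialKernel_coeff hp hΔ hh hl hsep habs
  have hbex : ∀ u ∈ I, ∃ b : Fin (n + 1) → ℝ,
      (∀ i, ∑ l, b l * radialKernel p h (x i) (x l) = radialKernel p h u (x i)) ∧
        ∀ i, |b i| ≤ 1 / 400 := fun u hu => by
    obtain ⟨b, hb, hbM, -⟩ := exists_radialKernel_coeff hp hΔ hh hl hsep
      (w := fun i => radialKernel p h u (x i)) (M := 1 / 450) (fun i => by
        rw [abs_of_pos (radialKernel_pos _ _ _ _)]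
        exact radialKernel_le hp hΔ hh hl (hdist u hu i))
    exact ⟨b, hb, fun i => (hbM i).trans (by norm_num)⟩
  choose! b hb hbM using hbex
  have hq : ∀ u ∈ I, 0 < 1 - ∑ l, b u l * radialKernel p h u (x l) := fun u hu => by
    have := abs_sum_mul_radialKernel_le hp hΔ hh hl hsep (hdist u hu) (by norm_num) (hbM u hu)
    linarith [(abs_le.1 this).2]
  have hcur := fun u hu => (hk u hu).existsUnique_isMinNormInterpolant (x := x)
    (fun i => hX u hu (Or.inr ⟨i, rfl⟩)) ha
  have hnew := fun u hu => (hk u hu).existsUnique_isMinNormInterpolant_insert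
    (radialKernel_comm p h) (x := x) (fun i => hX u hu (Or.inr ⟨i, rfl⟩)) (hX u hu (Or.inl rfl))
    ha (hb u hu) (radialKernel_self hp h u) (hq u hu).ne'
  refine ⟨fun u hu => ⟨(hcur u hu).1, fun t _ => (hnew u hu t).1⟩, ?_⟩
  intro f fnew hf hfnew
  -- Multiplying by `η` normalises the left label to `+1`.
  have hα : ∀ i, |η * a i| ≤ 2 := fun i => by
    rw [abs_mul, show |η| = 1 by rcases hη2 with h | h <;> rw [h] <;> norm_num]
    linarith [haM i]
  have hαj : 99 / 100 ≤ η * a j.castSucc := by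
    have h1 := abs_le.1 (hay j.castSucc)
    rw [← hη] at h1
    rcases hη2 with h | h <;> rw [h] at h1 ⊢ <;> linarith [h1.1, h1.2]
  have hαj' : η * a j.succ ≤ -(99 / 100) := by
    have h1 := abs_le.1 (hay j.succ)
    rw [hy'] at h1
    rcases hη2 with h | h <;> rw [h] at h1 ⊢ <;> linarith [h1.1, h1.2]
  have hmono := fun u (hu : u ∈ I) v (hv : v ∈ I) (huv : u < v) =>
    gap_monotonicity hp hΔ hh hl hsep hgap (hI ▸ hu : u ∈ Set.Icc _ _).1 huv
      (hI ▸ hv : v ∈ Set.Icc _ _).2 hα hαj hαj' (hb u hu) (hb v hv) (hbM u hu) (hbM v hv)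
  have hmulsum : ∀ u, ∑ l, η * a l * radialKernel p h u (x l) =
      η * ∑ l, a l * radialKernel p h u (x l) := fun u => by
    rw [Finset.mul_sum]
    exact Finset.sum_congr rfl fun l _ => mul_assoc _ _ _
  have hval : ∀ u ∈ I, valueAt (f u) u = ∑ l, a l * radialKernel p h u (x l) := fun u hu =>
    ((hcur u hu).2 _ (hf u hu)).1 u (hX u hu (Or.inl rfl))
  have hnorm := fun u (hu : u ∈ I) t ht => (hnew u hu t).2 _ (hfnew u hu t ht)
  have hnη : -η = 1 ∨ -η = -1 := by rcases hη2 with h | h <;> rw [h] <;> norm_num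
  have hpos : StrictMonoOn (fun u => ‖fnew η u‖) I := by
    intro u hu v hv huv
    have h1 := (hmono u hu v hv huv).2.1
    apply lt_of_pow_lt_pow_left₀ 2 (norm_nonneg _)
    simp only
    rw [hnorm u hu η hη2, hnorm v hv η hη2]
    have hsq : ∀ G : ℝ, (η - G) ^ 2 = (1 - η * G) ^ 2 := fun G => by
      linear_combination (1 - G ^ 2) * hηη
    rw [hmulsum, hmulsum] at h1
    rw [hsq, hsq]
    linarith
  have hneg : StrictAntiOn (fun u => ‖fnew (-η) u‖) I := by
    intro u hu v hv huv
    have h1 := (hmono u hu v hv huv).2.2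
    apply lt_of_pow_lt_pow_left₀ 2 (norm_nonneg _)
    simp only
    rw [hnorm u hu _ hnη, hnorm v hv _ hnη]
    have hsq : ∀ G : ℝ, (-η - G) ^ 2 = (1 + η * G) ^ 2 := fun G => by
      linear_combination (1 - G ^ 2) * hηη
    rw [hmulsum, hmulsum] at h1
    rw [hsq, hsq]
    linarith
  refine ⟨hpos, by rw [hy']; exact hneg, ?_, ?_, ?_⟩
  · intro u hu v hv huv
    have h1 := (hmono u hu v hv huv).1
    rw [hmulsum, hmulsum] at h1
    simp only
    rwa [hval u hu, hval v hv]
  · intro h3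
    -- The gap length `3 * Δ` keeps each end of `I` at distance `2 * Δ` from the far neighbour, so
    -- `η * F` has opposite signs at the two ends.
    have hleft : 0 < ∑ l, η * a l * radialKernel p h (x j.castSucc + Δ) (x l) := by
      refine sum_mul_radialKernel_pos (i := j.castSucc) hp hΔ hh hl hsep ?_ ?_ hα (by linarith)
      · rw [add_sub_cancel_left, abs_of_pos hΔ]
      · intro k hk
        have h4 := hsep k _ hk
        rw [le_abs] at h4 ⊢
        rcases hgap k with h5 | h5
        · left
          rcases h4 with h4 | h4 <;> linarith
        · right
          linarith
    have hright : 0 < ∑ l, -(η * a l) * radialKernel p h (x j.succ - Δ) (x l) := by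
      refine sum_mul_radialKernel_pos (i := j.succ) hp hΔ hh hl hsep ?_ ?_
        (fun i => by rw [abs_neg]; exact hα i) (by linarith)
      · rw [sub_sub_cancel_left, abs_neg, abs_of_pos hΔ]
      · intro k hk
        have h4 := hsep k _ hk
        rw [le_abs] at h4 ⊢
        rcases hgap k with h5 | h5
        · left
          linarith
        · right
          rcases h4 with h4 | h4 <;> linarith
    simp only [neg_mul, Finset.sum_neg_distrib] at hright
    obtain ⟨u, hu, hu0⟩ := intermediate_value_Icc'
      (f := fun u => ∑ l, η * a l * radialKernel p h u (x l))
      (by linarith : x j.castSucc + Δ ≤ x j.succ - Δ)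
      (continuous_finsetSum _ fun l _ => (continuous_radialKernel hp (x l)).const_mul _).continuousOn
      (show (0 : ℝ) ∈ Set.Icc _ _ from ⟨by linarith, hleft.le⟩)
    have huI : u ∈ I := hI ▸ hu
    refine ⟨u, huI, ?_⟩
    rw [hval u huI]
    simp only [hmulsum] at hu0
    rcases mul_eq_zero.1 hu0 with h | h
    · rw [h] at hηη
      norm_num at hηη
    · exact h
  · intro us hus h0
    have heq : ‖fnew 1 us‖ = ‖fnew (-1) us‖ := by
      rw [hval us hus] at h0
      have h1 := hnorm us hus 1 (Or.inl rfl)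
      have h2 := hnorm us hus (-1) (Or.inr rfl)
      rw [h0] at h1 h2
      rw [← sq_eq_sq₀ (norm_nonneg _) (norm_nonneg _), h1, h2]
      norm_num
    refine ⟨heq, fun u hu hne => ?_⟩
    have hscore : ∀ u, normScore (fnew 1 u) (fnew (-1) u) = min ‖fnew η u‖ ‖fnew (-η) u‖ := by
      intro u
      unfold normScore
      rcases hη2 with h | h <;> rw [h]
      rw [neg_neg, min_comm]
    have heq' : ‖fnew η us‖ = ‖fnew (-η) us‖ := by
      rcases hη2 with h | h <;> rw [h]
      · exact heq
      · rw [neg_neg]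
        exact heq.symm
    -- Left of `us` the increasing norm is below the common value, right of it the decreasing one.
    rw [hscore, hscore, ← heq', min_self]
    rcases lt_or_gt_of_ne hne with h | h
    · exact (min_le_left _ _).trans_lt (hpos hu hus h)
    · rw [heq']
      exact (min_le_right _ _).trans_lt (hneg hus hu h)
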